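/- Links are unoriented links in $S^3$, given by diagrams up to isotopy (planar isotopy and Reidemeister moves). A $5$-move replaces two parallel arcs of a link diagram by five half twists (of either handedness), and two links are $5$-move equivalent if one is obtained from the other by finitely many $5$-moves, their inverses and isotopies. For coprime integers $p,q$, a rational link of type $\frac{p}{q}$ is the numerator closure of Conway's rational tangle $[\frac{p}{q}]$ (with $[\frac10]=[\infty]$). **Corollary 2.12.** Let $p,q$ be coprime integers. A rational link of type $\frac{p}{q}$ is (i) $5$-move equivalent to the trivial link $T_2$ of two components if and only if $p\equiv 0 \pmod 5$ and $q\equiv \pm 1 \pmod 5$; (ii) $5$-move equivalent to the figure eight knot $4_1$ if and only if $p\equiv 0 \pmod 5$ and $q\equiv \pm 2 \pmod 5$; (iii) $5$-move equivalent to the trivial knot $T_1$ if and only if $p\equiv \pm 1 \pmod 5$; (iv) $5$-move equivalent to the Hopf link $H$ if and only if $p\equiv \pm 2 \pmod 5$. -/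

import Mathlib

/-! # Unoriented link diagrams, 5-moves and rational links

Links are treated diagrammatically: a link is a link diagram in the plane up to planar isotopy and
the three Reidemeister moves.  A planar diagram is put in general position with respect to the
height function and cut into horizontal slices, each of which contains a single local minimum, a
single local maximum or a single crossing, all other strands being vertical.  Reading the slices
from bottom to top, a diagram is a finite list of events.  Two sliced diagrams present isotopic
tangles if and only if they are related by the local replacements listed in `IsotopyMove` below. -/

namespace FiveMove

/-- What happens in a slice: a local minimum (`cup`), a local maximum (`cap`) or a crossing of two
neighbouring strands.  In `cross true` the overcrossing strand runs from bottom left to top right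
(positive slope), in `cross false` it runs from bottom right to top left (negative slope). -/
inductive Shape where
  | cup : Shape
  | cap : Shape
  | cross (b : Bool) : Shape

/-- Number of strands that enter an event from below. -/
def Shape.inputs : Shape → ℕ
  | .cup => 0
  | .cap => 2
  | .cross _ => 2

/-- Number of strands that leave an event at the top. -/
def Shape.outputs : Shape → ℕ
  | .cup => 2
  | .cap => 0
  | .cross _ => 2

/-- An elementary slice: the event `shape` with exactly `pos` vertical strands to its left. -/
structure Event where
  shape : Shape
  pos : ℕ

def cup (i : ℕ) : Event := ⟨.cup, i⟩

def cap (i : ℕ) : Event := ⟨.cap, i⟩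

def cross (b : Bool) (i : ℕ) : Event := ⟨.cross b, i⟩

/-- The number of strands above the event if there are `n` strands below it; `none` if the event
does not fit on `n` strands. -/
def Event.widthAbove (n : ℕ) (e : Event) : Option ℕ :=
  if e.pos + e.shape.inputs ≤ n then some (n - e.shape.inputs + e.shape.outputs) else none

/-- The number of strands above a list of slices (read from bottom to top) if there are `n` strands
below it; `none` if the slices do not fit together. -/
def widthAbove : ℕ → List Event → Option ℕ
  | n, [] => some n
  | n, e :: w => (e.widthAbove n).bind fun k => widthAbove k w

theorem widthAbove_append (n : ℕ) (u v : List Event) :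
    widthAbove n (u ++ v) = (widthAbove n u).bind fun k => widthAbove k v := by
  induction u generalizing n with
  | nil => rfl
  | cons e u ih =>
    simp only [List.cons_append, widthAbove]
    cases e.widthAbove n with
    | none => rfl
    | some k => simpa using ih k

/-- A (sliced, unoriented) tangle diagram with `m` endpoints at the bottom and `n` at the top. -/
structure TangleDiagram (m n : ℕ) where
  word : List Event
  fits : widthAbove m word = some n

/-- A link diagram is a tangle diagram without endpoints. -/
abbrev LinkDiagram : Type := TangleDiagram 0 0

/-- Stacking the diagram `E` on top of the diagram `D`. -/
def TangleDiagram.stack {l m n : ℕ} (D : TangleDiagram l m) (E : TangleDiagram m n) :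
    TangleDiagram l n where
  word := D.word ++ E.word
  fits := by rw [widthAbove_append, D.fits]; exact E.fits

/-- The local replacements that generate isotopy of tangles: planar isotopy and Reidemeister
moves. -/
inductive IsotopyMove : List Event → List Event → Prop
  /-- Planar isotopy: two events lying side by side exchange their heights. -/
  | exchange (s t : Shape) (i k : ℕ) (h : i ≤ k) :
      IsotopyMove [⟨s, i⟩, ⟨t, k + s.outputs⟩] [⟨t, k + s.inputs⟩, ⟨s, i⟩]
  /-- Planar isotopy: straightening a strand. -/
  | zigzagLeft (i : ℕ) : IsotopyMove [cup (i + 1), cap i] []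
  | zigzagRight (i : ℕ) : IsotopyMove [cup i, cap (i + 1)] []
  /-- Planar isotopy: turning a crossing past a local minimum or a local maximum. -/
  | turnCup (b : Bool) (i : ℕ) :
      IsotopyMove [cup i, cross b (i + 1)] [cup (i + 1), cross (!b) i]
  | turnCap (b : Bool) (i : ℕ) :
      IsotopyMove [cross b (i + 1), cap i] [cross (!b) i, cap (i + 1)]
  /-- First Reidemeister move. -/
  | reidemeisterOneCup (b : Bool) (i : ℕ) : IsotopyMove [cup i, cross b i] [cup i]
  | reidemeisterOneCap (b : Bool) (i : ℕ) : IsotopyMove [cross b i, cap i] [cap i]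
  /-- Second Reidemeister move. -/
  | reidemeisterTwo (b : Bool) (i : ℕ) : IsotopyMove [cross b i, cross (!b) i] []
  /-- Third Reidemeister move. -/
  | reidemeisterThree (b : Bool) (i : ℕ) :
      IsotopyMove [cross b i, cross b (i + 1), cross b i]
        [cross b (i + 1), cross b i, cross b (i + 1)]

/-- The (±)5-move: two parallel strands, neighbouring in a slice, receive five half twists (of
either handedness). -/
inductive FiveTwist : List Event → List Event → Prop
  | twist (b : Bool) (i : ℕ) : FiveTwist [] (List.replicate 5 (cross b i))

/-- `E` arises from `D` by one local replacement allowed by `R`. -/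
def Replaces (R : List Event → List Event → Prop) {m n : ℕ} (D E : TangleDiagram m n) : Prop :=
  ∃ u a b v : List Event, R a b ∧ D.word = u ++ a ++ v ∧ E.word = u ++ b ++ v

/-- Two diagrams present isotopic tangles (for link diagrams: the same link). -/
def Isotopic {m n : ℕ} : TangleDiagram m n → TangleDiagram m n → Prop :=
  Relation.EqvGen (Replaces IsotopyMove)

/-- 5-move equivalence: the diagrams are connected by finitely many isotopies and 5-moves or their
inverses. -/
def FiveMoveEquiv {m n : ℕ} : TangleDiagram m n → TangleDiagram m n → Prop :=
  Relation.EqvGen fun D E => Replaces IsotopyMove D E ∨ Replaces FiveTwist D E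

/-! ## Rational tangles and links

The four endpoints SW, NW, NE, SE of a 2-tangle, in clockwise order, are pulled up to the positions
0, 1, 2, 3 at the top of the diagram. -/

/-- The tangle `[∞]`: the arcs SW–NW and NE–SE. -/
def tangleInfinity : TangleDiagram 0 4 := ⟨[cup 0, cup 2], rfl⟩

/-- The tangle `[0]`: the arcs SW–SE and NW–NE. -/
def tangleZero : TangleDiagram 0 4 := ⟨[cup 0, cup 1], rfl⟩

/-- Adds the tangle `[1]` (if `s = true`) or `[-1]` (if `s = false`) on the right, which is a half
twist of the ends NE and SE.  In the crossing `[1]` the overcrossing strand has positive slope when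
the ends NE and SE point to the right; once they have been turned to point upwards it has negative
slope. -/
def horizontalTwist (s : Bool) : TangleDiagram 4 4 := ⟨[cross (!s) 2], rfl⟩

/-- Multiplies by the vertical tangle `[1]` (if `s = true`) or `[-1]` (if `s = false`) on the top,
which is a half twist of the ends NW and NE. -/
def verticalTwist (s : Bool) : TangleDiagram 4 4 := ⟨[cross s 1], rfl⟩

/-- The sign `1` or `-1`. -/
def sign (s : Bool) : ℤ := if s then 1 else -1

/-- `T` is a diagram, built by Conway's procedure, of the rational tangle with fraction `p / q`
(where `1 / 0 = ∞`).  A horizontal twist changes the fraction `f` to `f ± 1`, and a vertical twist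
changes it to `1 / (1 / f ± 1)`. -/
inductive IsRationalTangle : TangleDiagram 0 4 → ℤ → ℤ → Prop
  | infinity : IsRationalTangle tangleInfinity 1 0
  | zero : IsRationalTangle tangleZero 0 1
  | horizontal {T : TangleDiagram 0 4} {p q : ℤ} (s : Bool) (h : IsRationalTangle T p q) :
      IsRationalTangle (T.stack (horizontalTwist s)) (p + sign s * q) q
  | vertical {T : TangleDiagram 0 4} {p q : ℤ} (s : Bool) (h : IsRationalTangle T p q) :
      IsRationalTangle (T.stack (verticalTwist s)) p (q + sign s * p)

/-- The numerator of a 2-tangle: NW is joined to NE, and SW to SE. -/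
def numerator (T : TangleDiagram 0 4) : LinkDiagram :=
  T.stack ⟨[cap 1, cap 0], rfl⟩

/-- `L` is a diagram of a rational link of type `p / q` (for coprime `p` and `q`): up to isotopy it
is the numerator of a rational tangle whose fraction is `p / q = (-p) / (-q)`. -/
def IsRationalLink (L : LinkDiagram) (p q : ℤ) : Prop :=
  ∃ T : TangleDiagram 0 4,
    (IsRationalTangle T p q ∨ IsRationalTangle T (-p) (-q)) ∧ Isotopic L (numerator T)

/-! ## The four links -/

/-- The trivial knot: a round circle. -/
def trivialKnot : LinkDiagram := ⟨[cup 0, cap 0], rfl⟩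

/-- The trivial link of two components: two circles, one above the other. -/
def trivialLinkTwo : LinkDiagram := ⟨[cup 0, cap 0, cup 0, cap 0], rfl⟩

/-- The Hopf link: two circles side by side, clasped by two crossings. -/
def hopfLink : LinkDiagram :=
  ⟨[cup 0, cup 2, cross true 1, cross true 1, cap 0, cap 0], rfl⟩

/-- The figure eight knot `4₁`: the alternating diagram with four crossings whose Conway notation
is `2 2`. -/
def figureEight : LinkDiagram :=
  ⟨[cup 0, cup 2, cross true 1, cross true 1, cross false 2, cross false 2, cap 1, cap 0], rfl⟩

end FiveMove

/-!
At a value of `A` for which `A⁴` is a root of the tenth cyclotomic polynomial, the Kauffman bracket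
changes only by 40th roots of unity under isotopies and 5-moves, and its 40th power tells the four
links apart. Conversely, modulo 5-moves the two half twists are elements of order dividing 5
satisfying a braid relation, and these relations force a rational tangle to depend only on its
slope modulo 5, up to a common sign of numerator and denominator. The numerators of the twelve
classes of tangles that remain are the four links.
-/

namespace FiveMove

/-! ### The Kauffman bracket -/

/-- The algebraic input of the Kauffman bracket: values in an `R`-algebra `E` of a local minimum
and a local maximum on the two leftmost strands, together with an operation `shift` that adds one
vertical strand on the left.  The laws say that a closed circle is worth `-A ^ 2 - A⁻¹ ^ 2`, that
zigzags can be straightened, and that events far from each other commute. -/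
structure BracketModel (R E : Type*) [CommRing R] [Ring E] [Algebra R E] where
  A : Rˣ
  shift : E →ₐ[R] E
  cup : E
  cap : E
  cap_mul_cup : cap * cup = (-(A : R) ^ 2 - (↑A⁻¹ : R) ^ 2) • (1 : E)
  cap_mul_shift_cup : cap * shift cup = 1
  shift_cap_mul_cup : shift cap * cup = 1
  shift_shift_mul_cup (T : E) : shift (shift T) * cup = cup * T
  cap_mul_shift_shift (T : E) : cap * shift (shift T) = T * cap

namespace BracketModel

variable {R E : Type*} [CommRing R] [Ring E] [Algebra R E] (M : BracketModel R E)

/-- The coefficient `A` or `A⁻¹` with which the vertical smoothing enters the bracket of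
`cross b`. -/
def weight (b : Bool) : Rˣ := bif b then M.A else M.A⁻¹

/-- The bracket of a closed circle. -/
def loopValue : R := -(M.A : R) ^ 2 - (↑M.A⁻¹ : R) ^ 2

/-- The Temperley–Lieb generator: a local maximum below a local minimum. -/
def hook : E := M.cup * M.cap

/-- The Kauffman bracket of a crossing of the two leftmost strands. -/
def crossing (b : Bool) : E := (M.weight b : R) • 1 + (↑(M.weight b)⁻¹ : R) • M.hook

theorem weight_not (b : Bool) : M.weight (!b) = (M.weight b)⁻¹ := by
  cases b <;> simp [weight]

theorem loopValue_eq_weight (b : Bool) :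
    M.loopValue = -(M.weight b : R) ^ 2 - (↑(M.weight b)⁻¹ : R) ^ 2 := by
  cases b <;> simp only [loopValue, weight, cond_true, cond_false, inv_inv]
  ring

theorem hook_mul_cup : M.hook * M.cup = M.loopValue • M.cup := by
  rw [hook, mul_assoc, M.cap_mul_cup, mul_smul_comm, mul_one, loopValue]

theorem cap_mul_hook : M.cap * M.hook = M.loopValue • M.cap := by
  rw [hook, ← mul_assoc, M.cap_mul_cup, smul_one_mul, loopValue]

theorem hook_mul_hook : M.hook * M.hook = M.loopValue • M.hook := by
  nth_rw 2 3 [hook]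
  rw [← mul_assoc, M.hook_mul_cup, smul_mul_assoc]

theorem hook_mul_shift_hook_mul_hook : M.hook * M.shift M.hook * M.hook = M.hook := by
  calc M.hook * M.shift M.hook * M.hook
    _ = M.cup * (M.cap * M.shift M.cup) * (M.shift M.cap * M.cup) * M.cap := by
      simp only [hook, map_mul, mul_assoc]
    _ = M.hook := by rw [M.cap_mul_shift_cup, M.shift_cap_mul_cup, mul_one, mul_one, hook]

theorem shift_hook_mul_hook_mul_shift_hook :
    M.shift M.hook * M.hook * M.shift M.hook = M.shift M.hook := by
  calc M.shift M.hook * M.hook * M.shift M.hook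
    _ = M.shift M.cup * (M.shift M.cap * M.cup) * (M.cap * M.shift M.cup) * M.shift M.cap := by
      simp only [hook, map_mul, mul_assoc]
    _ = M.shift M.hook := by
      rw [M.cap_mul_shift_cup, M.shift_cap_mul_cup, mul_one, mul_one, hook, map_mul]

theorem commute_shift_shift_hook (T : E) : Commute (M.shift (M.shift T)) M.hook := by
  rw [commute_iff_eq, hook, ← mul_assoc, M.shift_shift_mul_cup, mul_assoc, mul_assoc,
    M.cap_mul_shift_shift]

theorem commute_shift_shift_crossing (T : E) (b : Bool) :
    Commute (M.shift (M.shift T)) (M.crossing b) :=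
  ((Commute.one_right _).smul_right _).add_right ((M.commute_shift_shift_hook T).smul_right _)

theorem crossing_mul_cup (b : Bool) :
    M.crossing b * M.cup = (-(↑(M.weight b)⁻¹ : R) ^ 3) • M.cup := by
  have := (M.weight b).mul_inv
  rw [crossing, add_mul, smul_one_mul, smul_mul_assoc, M.hook_mul_cup, M.loopValue_eq_weight b]
  match_scalars
  grind

theorem cap_mul_crossing (b : Bool) :
    M.cap * M.crossing b = (-(↑(M.weight b)⁻¹ : R) ^ 3) • M.cap := by
  have := (M.weight b).mul_inv
  rw [crossing, mul_add, mul_smul_one, mul_smul_comm, M.cap_mul_hook, M.loopValue_eq_weight b]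
  match_scalars
  grind

theorem crossing_mul_crossing (b : Bool) : M.crossing b * M.crossing b =
    ((M.weight b : R) ^ 2) • 1 + (1 - (↑(M.weight b)⁻¹ : R) ^ 4) • M.hook := by
  have := (M.weight b).mul_inv
  simp only [crossing, mul_add, add_mul, smul_mul_assoc, mul_smul_comm, one_mul, mul_one,
    hook_mul_hook, M.loopValue_eq_weight b]
  match_scalars <;> grind

theorem crossing_not_mul_crossing (b : Bool) : M.crossing (!b) * M.crossing b = 1 := by
  have := (M.weight b).mul_inv
  simp only [crossing, weight_not, inv_inv, mul_add, add_mul, smul_mul_assoc, mul_smul_comm,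
    one_mul, mul_one, hook_mul_hook, M.loopValue_eq_weight b]
  match_scalars <;> grind

theorem crossing_braid (b : Bool) :
    M.crossing b * M.shift (M.crossing b) * M.crossing b =
      M.shift (M.crossing b) * M.crossing b * M.shift (M.crossing b) := by
  have := (M.weight b).mul_inv
  have shift_hook_mul_shift_hook := congrArg M.shift M.hook_mul_hook
  rw [map_mul, map_smul] at shift_hook_mul_shift_hook
  simp only [crossing, map_add, map_smul, map_one, mul_add, add_mul, smul_mul_assoc,
    mul_smul_comm, one_mul, mul_one, hook_mul_hook, shift_hook_mul_shift_hook,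
    hook_mul_shift_hook_mul_hook, shift_hook_mul_hook_mul_shift_hook, M.loopValue_eq_weight b]
  match_scalars <;> grind

theorem shift_crossing_mul_cup (b : Bool) :
    M.shift (M.crossing b) * M.cup = M.crossing (!b) * M.shift M.cup := by
  simp only [crossing, weight_not, inv_inv, hook, map_add, map_smul, map_one, map_mul, add_mul,
    smul_mul_assoc, one_mul, mul_assoc, M.shift_cap_mul_cup, M.cap_mul_shift_cup, mul_one]
  exact add_comm _ _

theorem cap_mul_shift_crossing (b : Bool) :
    M.cap * M.shift (M.crossing b) = M.shift M.cap * M.crossing (!b) := by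
  simp only [crossing, weight_not, inv_inv, hook, map_add, map_smul, map_one, map_mul, mul_add,
    mul_smul_comm, mul_one, ← mul_assoc, M.shift_cap_mul_cup, M.cap_mul_shift_cup, one_mul]
  exact add_comm _ _

/-- `A` is a root of the bracket of the figure eight knot; equivalently `A⁴` is a root of the
tenth cyclotomic polynomial. At such `A` the bracket survives 5-moves. -/
def IsFiveMoveRoot : Prop :=
  (M.A : R) ^ 8 - (M.A : R) ^ 4 + 1 - (↑M.A⁻¹ : R) ^ 4 + (↑M.A⁻¹ : R) ^ 8 = 0

variable {M}

theorem IsFiveMoveRoot.weight (hM : M.IsFiveMoveRoot) (b : Bool) :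
    (M.weight b : R) ^ 8 - (M.weight b : R) ^ 4 + 1 - (↑(M.weight b)⁻¹ : R) ^ 4 +
      (↑(M.weight b)⁻¹ : R) ^ 8 = 0 := by
  rw [IsFiveMoveRoot] at hM
  cases b <;> simp only [BracketModel.weight, cond_true, cond_false, inv_inv]
  · linear_combination hM
  · exact hM

theorem IsFiveMoveRoot.weight_pow_forty (hM : M.IsFiveMoveRoot) (b : Bool) :
    M.weight b ^ 40 = 1 := by
  have hinv := (M.weight b).mul_inv
  have hroot := hM.weight b
  have h20 : (M.weight b : R) ^ 20 = -1 := by grind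
  ext
  push_cast
  linear_combination ((M.weight b : R) ^ 20 - 1) * h20

theorem IsFiveMoveRoot.framing_mem_rootsOfUnity (hM : M.IsFiveMoveRoot) (b : Bool) :
    -(M.weight b)⁻¹ ^ 3 ∈ rootsOfUnity 40 R := by
  rw [mem_rootsOfUnity, Even.neg_pow (by decide), inv_pow, inv_pow, ← pow_mul, mul_comm, pow_mul,
    hM.weight_pow_forty, one_pow, inv_one]

theorem IsFiveMoveRoot.crossing_pow_five (hM : M.IsFiveMoveRoot) (b : Bool) :
    M.crossing b ^ 5 = (M.weight b : R) ^ 5 • (1 : E) := by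
  have hinv := (M.weight b).mul_inv
  have hroot := hM.weight b
  have hpow : M.crossing b ^ 5 =
      M.crossing b * M.crossing b * (M.crossing b * M.crossing b) * M.crossing b := by
    noncomm_ring
  rw [hpow, M.crossing_mul_crossing, crossing]
  simp only [mul_add, add_mul, smul_mul_assoc, mul_smul_comm, one_mul, mul_one, hook_mul_hook,
    M.loopValue_eq_weight b]
  match_scalars <;> grind

variable (M)

/-- The value of a slice with no strand to its left. -/
def shapeValue : Shape → E
  | .cup => M.cup
  | .cap => M.cap
  | .cross b => M.crossing b

/-- The value of a slice. -/
def eventValue (e : Event) : E := (M.shift ^ e.pos) (M.shapeValue e.shape)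

/-- The Kauffman bracket of a sliced diagram. Slices are read from bottom to top and operators are
composed from right to left. -/
def bracket : List Event → E
  | [] => 1
  | e :: w => bracket w * M.eventValue e

theorem bracket_append (u w : List Event) : M.bracket (u ++ w) = M.bracket w * M.bracket u := by
  induction u with
  | nil => rw [List.nil_append, bracket, mul_one]
  | cons e u ih => rw [List.cons_append, bracket, ih, mul_assoc, bracket]

theorem shift_pow_outputs_mul_shapeValue (s : Shape) (T : E) :
    (M.shift ^ s.outputs) T * M.shapeValue s = M.shapeValue s * (M.shift ^ s.inputs) T := by
  cases s with
  | cup => exact M.shift_shift_mul_cup T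
  | cap => exact (M.cap_mul_shift_shift T).symm
  | cross b => exact M.commute_shift_shift_crossing T b

theorem bracket_exchange (s t : Shape) {i k : ℕ} (h : i ≤ k) :
    M.bracket [⟨s, i⟩, ⟨t, k + s.outputs⟩] = M.bracket [⟨t, k + s.inputs⟩, ⟨s, i⟩] := by
  obtain ⟨j, rfl⟩ := Nat.exists_eq_add_of_le h
  have := congrArg (M.shift ^ i) (M.shift_pow_outputs_mul_shapeValue s
    ((M.shift ^ j) (M.shapeValue t)))
  simp only [map_mul, ← AlgHom.mul_apply, ← pow_add] at this
  simpa only [bracket, eventValue, one_mul, add_assoc, add_comm j] using this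

theorem bracket_isotopyMove (hM : M.IsFiveMoveRoot) {a b : List Event} (h : IsotopyMove a b) :
    MulAction.orbitRel (rootsOfUnity 40 R) E (M.bracket a) (M.bracket b) := by
  have of_eq {x y : E} (h : x = y) : MulAction.orbitRel (rootsOfUnity 40 R) E x y := h ▸ refl x
  cases h with
  | exchange s t i k h => exact of_eq (M.bracket_exchange s t h)
  | zigzagLeft i =>
    exact of_eq <| by
      simp only [bracket, eventValue, FiveMove.cup, FiveMove.cap, shapeValue, one_mul, pow_succ,
        AlgHom.mul_apply, ← map_mul, M.cap_mul_shift_cup, map_one]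
  | zigzagRight i =>
    exact of_eq <| by
      simp only [bracket, eventValue, FiveMove.cup, FiveMove.cap, shapeValue, one_mul, pow_succ,
        AlgHom.mul_apply, ← map_mul, M.shift_cap_mul_cup, map_one]
  | turnCup c i =>
    exact of_eq <| by
      simp only [bracket, eventValue, FiveMove.cup, cross, shapeValue, one_mul, pow_succ,
        AlgHom.mul_apply, ← map_mul, M.shift_crossing_mul_cup]
  | turnCap c i =>
    exact of_eq <| by
      simp only [bracket, eventValue, FiveMove.cap, cross, shapeValue, one_mul, pow_succ,
        AlgHom.mul_apply, ← map_mul, M.cap_mul_shift_crossing]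
  | reidemeisterOneCup c i =>
    refine ⟨⟨_, hM.framing_mem_rootsOfUnity c⟩, ?_⟩
    simp only [bracket, eventValue, FiveMove.cup, cross, shapeValue, one_mul, ← map_mul,
      M.crossing_mul_cup, map_smul]
    rfl
  | reidemeisterOneCap c i =>
    refine ⟨⟨_, hM.framing_mem_rootsOfUnity c⟩, ?_⟩
    simp only [bracket, eventValue, FiveMove.cap, cross, shapeValue, one_mul, ← map_mul,
      M.cap_mul_crossing, map_smul]
    rfl
  | reidemeisterTwo c i =>
    exact of_eq <| by
      simp only [bracket, eventValue, cross, shapeValue, one_mul, ← map_mul,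
        M.crossing_not_mul_crossing, map_one]
  | reidemeisterThree c i =>
    exact of_eq <| by
      simp only [bracket, eventValue, cross, shapeValue, one_mul, pow_succ, AlgHom.mul_apply,
        ← map_mul, M.crossing_braid, mul_assoc]

theorem bracket_fiveTwist (hM : M.IsFiveMoveRoot) {a b : List Event} (h : FiveTwist a b) :
    MulAction.orbitRel (rootsOfUnity 40 R) E (M.bracket b) (M.bracket a) := by
  obtain ⟨c, i⟩ := h
  have hc : M.weight c ^ 5 ∈ rootsOfUnity 40 R := by
    rw [mem_rootsOfUnity, ← pow_mul, mul_comm, pow_mul, hM.weight_pow_forty, one_pow]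
  have hbracket (n : ℕ) :
      M.bracket (List.replicate n (cross c i)) = (M.shift ^ i) (M.crossing c ^ n) := by
    induction n with
    | zero => simp [bracket]
    | succ n ih => rw [List.replicate_succ, bracket, ih, pow_succ, map_mul]; rfl
  refine ⟨⟨_, hc⟩, ?_⟩
  rw [hbracket, hM.crossing_pow_five, map_smul, map_one]
  rfl

theorem orbitRel_bracket_append {G : Type*} [Group G] [MulAction G E] [IsScalarTower G E E]
    [SMulCommClass G E E] {a b : List Event}
    (h : MulAction.orbitRel G E (M.bracket a) (M.bracket b)) (u v : List Event) :
    MulAction.orbitRel G E (M.bracket (u ++ a ++ v)) (M.bracket (u ++ b ++ v)) := by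
  obtain ⟨ζ, hζ⟩ := h
  refine ⟨ζ, ?_⟩
  simp only [bracket_append, ← hζ, smul_mul_assoc, mul_smul_comm]

theorem cap_mul_cup_mul (T : E) : M.cap * (M.cup * T) = M.loopValue • T := by
  rw [← mul_assoc, M.cap_mul_cup, smul_one_mul, loopValue]

theorem cap_mul_shift_cup_mul (T : E) : M.cap * (M.shift M.cup * T) = T := by
  rw [← mul_assoc, M.cap_mul_shift_cup, one_mul]

theorem shift_cap_mul_cup_mul (T : E) : M.shift M.cap * (M.cup * T) = T := by
  rw [← mul_assoc, M.shift_cap_mul_cup, one_mul]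

theorem bracket_trivialKnot : M.bracket trivialKnot.word = M.loopValue • 1 :=
  (congrArg (· * M.cup) (one_mul M.cap)).trans M.cap_mul_cup

theorem bracket_trivialLinkTwo : M.bracket trivialLinkTwo.word = M.loopValue ^ 2 • 1 := by
  change 1 * M.cap * M.cup * M.cap * M.cup = _
  rw [one_mul, M.cap_mul_cup, smul_one_mul, smul_mul_assoc, M.cap_mul_cup, smul_smul, loopValue,
    ← sq]

theorem bracket_hopfLink : M.bracket hopfLink.word =
    (-((M.A : R) ^ 4 + (↑M.A⁻¹ : R) ^ 4) * M.loopValue) • 1 := by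
  have hinv := M.A.mul_inv
  calc M.bracket hopfLink.word
    _ = M.cap * M.cap * M.shift (M.crossing true * M.crossing true) *
          (M.shift (M.shift M.cup) * M.cup) := by
      simp only [map_mul, ← mul_assoc]
      exact congrArg (· * M.cap * _ * _ * _ * _) (one_mul M.cap)
    _ = _ := by
      rw [M.shift_shift_mul_cup, M.crossing_mul_crossing, hook]
      simp only [map_add, map_smul, map_one, map_mul, mul_add, add_mul, mul_smul_comm, mul_one,
        smul_mul_assoc, mul_assoc, M.shift_cap_mul_cup_mul, M.cap_mul_shift_cup_mul,
        M.cap_mul_cup_mul, M.cap_mul_cup, weight, cond_true, loopValue]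
      match_scalars
      grind

theorem bracket_figureEight : M.bracket figureEight.word = (((M.A : R) ^ 8 - (M.A : R) ^ 4 + 1 -
    (↑M.A⁻¹ : R) ^ 4 + (↑M.A⁻¹ : R) ^ 8) * M.loopValue) • 1 := by
  have hinv := M.A.mul_inv
  have shift_cap_mul_shift_cup : M.shift M.cap * M.shift M.cup = M.loopValue • (1 : E) := by
    rw [← map_mul, M.cap_mul_cup, map_smul, map_one, loopValue]
  have opened : M.cap * M.shift (M.crossing false * M.crossing false) *
      (M.crossing true * M.crossing true) * M.shift M.cup =
        ((M.A : R) ^ 8 - (M.A : R) ^ 4 + 1 - (↑M.A⁻¹ : R) ^ 4 + (↑M.A⁻¹ : R) ^ 8) • 1 := by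
    rw [M.crossing_mul_crossing, M.crossing_mul_crossing, hook]
    simp only [map_add, map_smul, map_one, map_mul, mul_add, add_mul, mul_smul_comm, mul_one,
      smul_mul_assoc, M.shift_cap_mul_cup_mul, M.cap_mul_shift_cup_mul,
      M.cap_mul_cup_mul, M.cap_mul_shift_cup, shift_cap_mul_shift_cup, weight, cond_true,
      cond_false, inv_inv, loopValue]
    match_scalars
    grind
  calc M.bracket figureEight.word
    _ = M.cap * M.shift (M.cap * M.shift (M.crossing false * M.crossing false) *
          (M.crossing true * M.crossing true) * M.shift M.cup) * M.cup := by
      simp only [map_mul, ← mul_assoc]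
      exact congrArg (· * M.shift M.cap * _ * _ * _ * _ * _ * _) (one_mul M.cap)
    _ = _ := by
      rw [opened, map_smul, map_one, mul_smul_one, smul_mul_assoc, M.cap_mul_cup, smul_smul,
        loopValue]

end BracketModel

theorem FiveMoveEquiv.orbitRel_bracket {R E : Type*} [CommRing R] [Ring E] [Algebra R E]
    (M : BracketModel R E) (hM : M.IsFiveMoveRoot) {m n : ℕ} {D D' : TangleDiagram m n}
    (h : FiveMoveEquiv D D') :
    MulAction.orbitRel (rootsOfUnity 40 R) E (M.bracket D.word) (M.bracket D'.word) := by
  refine Setoid.eqvGen_le (s := (MulAction.orbitRel (rootsOfUnity 40 R) E).comap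
    fun D : TangleDiagram m n => M.bracket D.word) ?_ h
  rintro D D' (⟨u, a, b, v, h, hD, hD'⟩ | ⟨u, a, b, v, h, hD, hD'⟩)
  · rw [Setoid.comap_rel, hD, hD']
    exact M.orbitRel_bracket_append (M.bracket_isotopyMove hM h) u v
  · rw [Setoid.comap_rel, hD, hD']
    exact M.orbitRel_bracket_append (symm (M.bracket_fiveTwist hM h)) u v

theorem FiveMoveEquiv.pow_forty_eq {R E : Type*} [CommRing R] [Ring E] [Algebra R E]
    [FaithfulSMul R E] (M : BracketModel R E) (hM : M.IsFiveMoveRoot) {m n : ℕ}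
    {D D' : TangleDiagram m n} (h : FiveMoveEquiv D D') {c c' : R}
    (hc : M.bracket D.word = c • 1) (hc' : M.bracket D'.word = c' • 1) : c ^ 40 = c' ^ 40 := by
  obtain ⟨⟨ζ, hζ⟩, h⟩ := h.orbitRel_bracket M hM
  have hcc : (ζ : R) * c' = c := by
    apply FaithfulSMul.algebraMap_injective R E
    rw [Algebra.algebraMap_eq_smul_one, Algebra.algebraMap_eq_smul_one, ← hc, ← h, mul_smul,
      ← hc']
    rfl
  have hζ : (ζ : R) ^ 40 = 1 := by
    simpa using congrArg Units.val ((mem_rootsOfUnity 40 ζ).mp hζ)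
  rw [← hcc, mul_pow, hζ, one_mul]

/-! ### The spin representation -/

section SpinModel

variable {R : Type*} [CommRing R]

/-- Functions of the spins, up or down, of infinitely many strands: the representation of the
Temperley–Lieb algebra in which the bracket is computed. -/
abbrev SpinFunction (R : Type*) : Type _ := Stream' Bool → R

/-- The weight with which a local minimum creates two strands of the given spins. -/
def cupWeight (A : Rˣ) : Bool → Bool → R
  | false, true => 1
  | true, false => -(A : R) ^ 2
  | _, _ => 0

/-- The operator of a local minimum on the two leftmost strands. -/
def spinCup (A : Rˣ) : Module.End R (SpinFunction R) :=
  LinearMap.mulLeft R (fun s => cupWeight A s.head s.tail.head) ∘ₗ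
    LinearMap.funLeft R R fun s => s.tail.tail

/-- The operator of a local maximum on the two leftmost strands, which have to have opposite
spins. -/
def spinCap (A : Rˣ) : Module.End R (SpinFunction R) :=
  (-(↑A⁻¹ : R) ^ 2) • LinearMap.funLeft R R (fun s => Stream'.cons false (Stream'.cons true s)) +
    LinearMap.funLeft R R fun s => Stream'.cons true (Stream'.cons false s)

/-- The operation of letting an operator act on all strands but the leftmost one. -/
def spinShift : Module.End R (SpinFunction R) →ₐ[R] Module.End R (SpinFunction R) where
  toFun T := LinearMap.pi fun s =>
    LinearMap.proj s.tail ∘ₗ T ∘ₗ LinearMap.funLeft R R (Stream'.cons s.head)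
  map_one' := by ext f s; simp [LinearMap.funLeft_apply, Stream'.eta]
  map_mul' _ _ := rfl
  map_zero' := rfl
  map_add' _ _ := rfl
  commutes' c := by
    ext f s
    simp [Module.algebraMap_end_apply, LinearMap.funLeft_apply, Stream'.eta]

@[simp]
theorem spinCup_apply (A : Rˣ) (f : SpinFunction R) (s : Stream' Bool) :
    spinCup A f s = cupWeight A s.head s.tail.head * f s.tail.tail :=
  rfl

@[simp]
theorem spinCap_apply (A : Rˣ) (f : SpinFunction R) (s : Stream' Bool) :
    spinCap A f s = -(↑A⁻¹ : R) ^ 2 * f (Stream'.cons false (Stream'.cons true s)) +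
      f (Stream'.cons true (Stream'.cons false s)) :=
  rfl

@[simp]
theorem spinShift_apply (T : Module.End R (SpinFunction R)) (f : SpinFunction R)
    (s : Stream' Bool) : spinShift T f s = T (fun r => f (Stream'.cons s.head r)) s.tail :=
  rfl

/-- The bracket model given by the spins of the strands. -/
def spinModel (A : Rˣ) : BracketModel R (Module.End R (SpinFunction R)) where
  A := A
  shift := spinShift
  cup := spinCup A
  cap := spinCap A
  cap_mul_cup := by
    ext f s
    simp only [Module.End.mul_apply, spinCap_apply, spinCup_apply, cupWeight,
      Stream'.get_zero_cons, Stream'.tail_cons, one_mul, neg_mul, LinearMap.smul_apply,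
      Module.End.one_apply, Pi.smul_apply, smul_eq_mul]
    ring
  cap_mul_shift_cup := by
    have := A.inv_mul
    ext f s
    obtain ⟨a, s, rfl⟩ : ∃ a r, s = Stream'.cons a r := ⟨_, _, (Stream'.eta s).symm⟩
    cases a <;> simp only [Module.End.mul_apply, spinCap_apply, spinShift_apply, spinCup_apply,
      Stream'.get_zero_cons, Stream'.tail_cons, cupWeight, Module.End.one_apply] <;> grind
  shift_cap_mul_cup := by
    have := A.inv_mul
    ext f s
    obtain ⟨a, s, rfl⟩ : ∃ a r, s = Stream'.cons a r := ⟨_, _, (Stream'.eta s).symm⟩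
    cases a <;> simp only [Module.End.mul_apply, spinCap_apply, spinShift_apply, spinCup_apply,
      Stream'.get_zero_cons, Stream'.tail_cons, cupWeight, Module.End.one_apply] <;> grind
  shift_shift_mul_cup T := by
    ext f s
    exact congrFun (T.map_smul (cupWeight A s.head s.tail.head) f) s.tail.tail
  cap_mul_shift_shift T := by
    ext f s
    have hT : T (spinCap A f) = _ := T.map_add _ _
    simp only [LinearMap.smul_apply, map_smul] at hT
    exact (congrFun hT s).symm

end SpinModel

instance fact_prime_241 : Fact (Nat.Prime 241) := ⟨by norm_num⟩

/-- The bracket at a primitive 40th root of unity. -/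
def modularModel : BracketModel (ZMod 241) (Module.End (ZMod 241) (SpinFunction (ZMod 241))) :=
  -- `5` has order 40 modulo 241. The smaller prime 41 also has units of order 40, but there the
  -- 40th powers of all units are `1`.
  spinModel ⟨5, 193, by decide, by decide⟩

theorem isFiveMoveRoot_modularModel : modularModel.IsFiveMoveRoot := by
  unfold BracketModel.IsFiveMoveRoot
  decide

/-! ### Slopes modulo 5 -/

instance fact_prime_five : Fact (Nat.Prime 5) := ⟨Nat.prime_five⟩

section Slopes

variable {G Q : Type*} [Group G] [MulAction G Q]

/-- The relations satisfied, modulo 5-moves, by the horizontal half twist `h` and the vertical half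
twist `v` acting on tangles, with `zero` and `inf` the tangles of slope `0` and `∞`. -/
structure TwistRelations (h v : G) (zero inf : Q) : Prop where
  braid : v * h⁻¹ * v = h⁻¹ * v * h⁻¹
  h_pow : h ^ 5 = 1
  v_pow : v ^ 5 = 1
  h_inf : h • inf = inf
  v_zero : v • zero = zero
  v_inf : v • inf = h • zero
  v_inv_inf : v⁻¹ • inf = h⁻¹ • zero

/-- The tangle of slope `0 / y` for a nonzero residue `y` modulo 5; for `y = ±2` it is the tangle
`2 + 1 / 2 = 5 / 2`.  Reversing the roles of the two twists gives the tangle of slope `x / 0`. -/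
def axisPoint (h v : G) (zero inf : Q) (y : ZMod 5) : Q :=
  if y ^ 2 = 1 then zero else h ^ 2 • v ^ 2 • inf

/-- The tangle of slope `x / y` for residues `x` and `y` modulo 5 that are not both zero. -/
def slopePoint (h v : G) (zero inf : Q) (x y : ZMod 5) : Q :=
  if y = 0 then axisPoint v h inf zero x else h ^ (x * y⁻¹).val • axisPoint h v zero inf y

theorem axisPoint_neg (h v : G) (zero inf : Q) (y : ZMod 5) :
    axisPoint h v zero inf (-y) = axisPoint h v zero inf y := by
  rw [axisPoint, axisPoint, neg_sq]

theorem slopePoint_neg (h v : G) (zero inf : Q) (x y : ZMod 5) :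
    slopePoint h v zero inf (-x) (-y) = slopePoint h v zero inf x y := by
  simp only [slopePoint, neg_eq_zero, axisPoint_neg, inv_neg, neg_mul_neg]

theorem pow_val_add {f : G} (hf : f ^ 5 = 1) (a b : ZMod 5) :
    f ^ (a + b).val = f ^ a.val * f ^ b.val := by
  rw [ZMod.val_add, ← pow_add, ← pow_eq_pow_mod _ hf]

theorem pow_four_eq_inv {f : G} (hf : f ^ 5 = 1) : f ^ 4 = f⁻¹ := by
  rw [eq_inv_iff_mul_eq_one, ← pow_succ, hf]

namespace TwistRelations

variable {h v : G} {zero inf : Q}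

theorem symm (T : TwistRelations h v zero inf) : TwistRelations v h inf zero where
  braid := by simpa only [mul_inv_rev, inv_inv, mul_assoc] using (congrArg (·⁻¹) T.braid).symm
  h_pow := T.v_pow
  v_pow := T.h_pow
  h_inf := T.v_zero
  v_zero := T.h_inf
  v_inf := T.v_inf.symm
  v_inv_inf := T.v_inv_inf.symm

/-- The quarter turn `v * h⁻¹ * v` of tangles exchanges the two kinds of twists. -/
theorem semiconjBy_v (T : TwistRelations h v zero inf) : SemiconjBy (v * h⁻¹ * v) v h⁻¹ := by
  calc v * h⁻¹ * v * v
    _ = h⁻¹ * v * h⁻¹ * v := by rw [T.braid]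
    _ = h⁻¹ * (v * h⁻¹ * v) := by simp only [mul_assoc]

theorem semiconjBy_h_inv (T : TwistRelations h v zero inf) :
    SemiconjBy (v * h⁻¹ * v) h⁻¹ v := by
  calc v * h⁻¹ * v * h⁻¹
    _ = v * (h⁻¹ * v * h⁻¹) := by simp only [mul_assoc]
    _ = v * (v * h⁻¹ * v) := by rw [T.braid]

theorem quarterTurn_inf (T : TwistRelations h v zero inf) : (v * h⁻¹ * v) • inf = zero := by
  rw [mul_smul, mul_smul, T.v_inf, inv_smul_smul, T.v_zero]

theorem quarterTurn_zero (T : TwistRelations h v zero inf) : (v * h⁻¹ * v) • zero = inf := by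
  rw [T.braid, mul_smul, mul_smul, ← T.v_inv_inf, smul_inv_smul, inv_smul_eq_iff, T.h_inf]

theorem v_h_inv_v_pow_inf (T : TwistRelations h v zero inf) (n : ℕ) :
    v • h⁻¹ • v ^ (n + 1) • inf = (h ^ n)⁻¹ • zero := by
  calc v • h⁻¹ • v ^ (n + 1) • inf
    _ = (v * h⁻¹ * v * v ^ n) • inf := by simp only [smul_smul, pow_succ', mul_assoc]
    _ = (h ^ n)⁻¹ • zero := by
      rw [(T.semiconjBy_v.pow_right n).eq, mul_smul, T.quarterTurn_inf, inv_pow]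

theorem v_h_sq (T : TwistRelations h v zero inf) : v * h ^ 2 = h * v ^ 2 * (v * h⁻¹ * v) := by
  have h_sq : h ^ 2 = h⁻¹ ^ 3 := by
    rw [inv_pow, eq_inv_iff_mul_eq_one, ← pow_add, T.h_pow]
  calc v * h ^ 2
    _ = h * (h⁻¹ * v * h⁻¹) * h⁻¹ ^ 2 := by rw [h_sq]; group
    _ = h * v ^ 2 * (v * h⁻¹ * v) := by
      rw [← T.braid, mul_assoc, (T.semiconjBy_h_inv.pow_right 2).eq, ← mul_assoc]

theorem h_inv_v_sq_inf (T : TwistRelations h v zero inf) :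
    h⁻¹ • v ^ 2 • inf = (v ^ 2)⁻¹ • inf := by
  rw [eq_inv_smul_iff, sq, mul_smul, ← sq, T.v_h_inv_v_pow_inf 1, pow_one, ← T.v_inv_inf,
    smul_inv_smul]

theorem h_v_sq_inf (T : TwistRelations h v zero inf) : h • v ^ 2 • inf = v • h ^ 2 • zero := by
  rw [smul_smul v, T.v_h_sq, mul_smul, T.quarterTurn_zero, mul_smul]

theorem h_inv_v_inv_sq_inf (T : TwistRelations h v zero inf) :
    h⁻¹ • (v ^ 2)⁻¹ • inf = v⁻¹ • (h ^ 2)⁻¹ • zero := by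
  have v_inv_sq : (v ^ 2)⁻¹ = v ^ 3 := by rw [inv_eq_iff_mul_eq_one, ← pow_add, T.v_pow]
  rw [eq_inv_smul_iff, v_inv_sq, T.v_h_inv_v_pow_inf 2]

theorem v_h_sq_v_sq_inf (T : TwistRelations h v zero inf) :
    v • h ^ 2 • v ^ 2 • inf = h ^ 2 • v ^ 2 • inf := by
  calc v • h ^ 2 • v ^ 2 • inf
    _ = h • v ^ 2 • (v * h⁻¹ * v * v ^ 2) • inf := by
      rw [smul_smul v, T.v_h_sq]
      simp only [mul_smul]
    _ = h • v ^ 2 • (h ^ 2)⁻¹ • zero := by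
      rw [(T.semiconjBy_v.pow_right 2).eq, mul_smul, T.quarterTurn_inf, inv_pow]
    _ = h • v • h ^ 2 • zero := by
      rw [← T.symm.h_inv_v_sq_inf, sq v, mul_smul, smul_inv_smul]
    _ = h ^ 2 • v ^ 2 • inf := by rw [← T.h_v_sq_inf, smul_smul, sq h]

theorem v_axisPoint (T : TwistRelations h v zero inf) (y : ZMod 5) :
    v • axisPoint h v zero inf y = axisPoint h v zero inf y := by
  rw [axisPoint]
  split_ifs
  · exact T.v_zero
  · exact T.v_h_sq_v_sq_inf

theorem h_pow_three_v_sq_inf (T : TwistRelations h v zero inf) :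
    h ^ 3 • v ^ 2 • inf = v ^ 3 • h ^ 2 • zero := by
  have pow_three {f : G} (hf : f ^ 5 = 1) : f ^ 3 = f⁻¹ * f⁻¹ := by
    rw [← mul_inv_rev, eq_inv_iff_mul_eq_one, ← sq, ← pow_add, hf]
  rw [pow_three T.h_pow, pow_three T.v_pow, mul_smul, mul_smul, T.h_inv_v_sq_inf,
    T.symm.h_inv_v_sq_inf, T.h_inv_v_inv_sq_inf]

theorem h_pow_four_v_sq_inf (T : TwistRelations h v zero inf) :
    h ^ 4 • v ^ 2 • inf = v ^ 3 • inf := by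
  have v_pow_three : v ^ 3 = (v ^ 2)⁻¹ := by rw [eq_inv_iff_mul_eq_one, ← pow_add, T.v_pow]
  rw [pow_four_eq_inv T.h_pow, T.h_inv_v_sq_inf, v_pow_three]

theorem h_pow_axisPoint (T : TwistRelations h v zero inf) {x y k l : ZMod 5} (hx : x = k * y)
    (hkl : k * l = 1) (hy : y ≠ 0) :
    h ^ k.val • axisPoint h v zero inf y = v ^ l.val • axisPoint v h inf zero x := by
  have hkl_cases : ∀ k l : ZMod 5, k * l = 1 →
      k = 1 ∧ l = 1 ∨ k = 2 ∧ l = 3 ∨ k = 3 ∧ l = 2 ∨ k = 4 ∧ l = 4 := by decide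
  have hsq : ∀ y : ZMod 5, y ≠ 0 → y ^ 2 = 1 ∨ y ^ 2 = -1 := by decide
  have pow_smul_pow_smul (f : G) (a b : ℕ) (z : Q) : f ^ a • f ^ b • z = f ^ (a + b) • z := by
    rw [smul_smul, pow_add]
  have val_one : (1 : ZMod 5).val = 1 := rfl
  have val_two : (2 : ZMod 5).val = 2 := rfl
  have val_three : (3 : ZMod 5).val = 3 := rfl
  have val_four : (4 : ZMod 5).val = 4 := rfl
  subst hx
  rcases hkl_cases k l hkl with ⟨rfl, rfl⟩ | ⟨rfl, rfl⟩ | ⟨rfl, rfl⟩ | ⟨rfl, rfl⟩ <;>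
    rcases hsq y hy with hy | hy <;>
    simp +decide only [axisPoint, mul_pow, hy, val_one, val_two, val_three, val_four, if_true,
      if_false, pow_smul_pow_smul, Nat.reduceAdd]
  · rw [pow_one, pow_one, T.v_inf]
  · exact T.h_pow_three_v_sq_inf
  · rw [T.v_pow, one_smul]
  · exact T.h_pow_four_v_sq_inf
  · exact T.symm.h_pow_four_v_sq_inf.symm
  · rw [T.h_pow, one_smul]
  · rw [pow_four_eq_inv T.h_pow, pow_four_eq_inv T.v_pow, T.v_inv_inf]
  · rw [pow_succ h 5, pow_succ v 5, T.h_pow, T.v_pow, one_mul, one_mul, T.h_v_sq_inf]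

theorem slopePoint_swap (T : TwistRelations h v zero inf) {x y : ZMod 5} (hxy : x ≠ 0 ∨ y ≠ 0) :
    slopePoint h v zero inf x y = slopePoint v h inf zero y x := by
  by_cases hx : x = 0 <;> by_cases hy : y = 0 <;> simp only [slopePoint, hx, hy, if_true, if_false,
    zero_mul, ZMod.val_zero, pow_zero, one_smul]
  · simp [hx, hy] at hxy
  · exact T.h_pow_axisPoint (by field_simp) (by field_simp) hy

theorem h_slopePoint (T : TwistRelations h v zero inf) (x y : ZMod 5) :
    h • slopePoint h v zero inf x y = slopePoint h v zero inf (x + y) y := by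
  by_cases hy : y = 0
  · simp only [slopePoint, hy, if_true, add_zero, T.symm.v_axisPoint]
  · rw [slopePoint, slopePoint, if_neg hy, if_neg hy, add_mul, mul_inv_cancel₀ hy,
      add_comm, pow_val_add T.h_pow, mul_smul]
    exact congrArg (· • _) (pow_one h).symm

theorem v_slopePoint (T : TwistRelations h v zero inf) {x y : ZMod 5} (hxy : x ≠ 0 ∨ y ≠ 0) :
    v • slopePoint h v zero inf x y = slopePoint h v zero inf x (y + x) := by
  have hxy' : x ≠ 0 ∨ y + x ≠ 0 := by grind
  rw [T.slopePoint_swap hxy, T.slopePoint_swap hxy', T.symm.h_slopePoint]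

end TwistRelations

end Slopes

/-! ### Rational tangles modulo 5-moves -/

/-- Tangle diagrams modulo 5-move equivalence. -/
def TangleClass (m n : ℕ) : Type :=
  Quot fun D E : TangleDiagram m n => Replaces IsotopyMove D E ∨ Replaces FiveTwist D E

/-- The class of a tangle diagram modulo 5-move equivalence. -/
def TangleDiagram.toClass {m n : ℕ} (D : TangleDiagram m n) : TangleClass m n := Quot.mk _ D

theorem toClass_eq_iff {m n : ℕ} {D E : TangleDiagram m n} :
    D.toClass = E.toClass ↔ FiveMoveEquiv D E :=
  Quot.eq

theorem toClass_eq_of_isotopyMove {m n : ℕ} {D E : TangleDiagram m n} (u v : List Event)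
    {a b : List Event} (h : IsotopyMove a b) (hD : D.word = u ++ a ++ v)
    (hE : E.word = u ++ b ++ v) : D.toClass = E.toClass :=
  Quot.sound (.inl ⟨u, a, b, v, h, hD, hE⟩)

theorem toClass_eq_of_fiveTwist {m n : ℕ} {D E : TangleDiagram m n} (u v : List Event)
    {a b : List Event} (h : FiveTwist a b) (hD : D.word = u ++ a ++ v)
    (hE : E.word = u ++ b ++ v) : D.toClass = E.toClass :=
  Quot.sound (.inr ⟨u, a, b, v, h, hD, hE⟩)

theorem Isotopic.toClass_eq {m n : ℕ} {D E : TangleDiagram m n} (h : Isotopic D E) :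
    D.toClass = E.toClass :=
  toClass_eq_iff.mpr (Relation.EqvGen.mono (fun _ _ => Or.inl) _ _ h)

theorem Replaces.stack {R : List Event → List Event → Prop} {l m n : ℕ} {D D' : TangleDiagram l m}
    (h : Replaces R D D') (E : TangleDiagram m n) : Replaces R (D.stack E) (D'.stack E) := by
  obtain ⟨u, a, b, v, h, hD, hD'⟩ := h
  exact ⟨u, a, b, v ++ E.word, h, by simp [TangleDiagram.stack, hD],
    by simp [TangleDiagram.stack, hD']⟩

/-- Stacking a diagram on top of a class of diagrams. -/
def TangleClass.stack {l m n : ℕ} (x : TangleClass l m) (E : TangleDiagram m n) : TangleClass l n :=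
  Quot.map (TangleDiagram.stack · E) (fun _ _ h => h.imp (·.stack E) (·.stack E)) x

theorem TangleClass.stack_stack_cross {m n : ℕ} {D E : TangleDiagram n n} {b : Bool} {i : ℕ}
    (hD : D.word = [cross b i]) (hE : E.word = [cross (!b) i]) (x : TangleClass m n) :
    (x.stack D).stack E = x := by
  induction x using Quot.ind with
  | mk T =>
    exact toClass_eq_of_isotopyMove T.word [] (.reidemeisterTwo b i)
      (by simp [TangleDiagram.stack, hD, hE]) (by simp)

/-- The permutation of classes of tangles given by stacking a half twist. -/
def twistPerm (m : ℕ) {n : ℕ} {D E : TangleDiagram n n} {b : Bool} {i : ℕ}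
    (hD : D.word = [cross b i]) (hE : E.word = [cross (!b) i]) : Equiv.Perm (TangleClass m n) where
  toFun x := x.stack D
  invFun x := x.stack E
  left_inv := TangleClass.stack_stack_cross hD hE
  right_inv := TangleClass.stack_stack_cross hE (by rwa [Bool.not_not])

/-- The half twist of the ends NE and SE, up to 5-moves. -/
def horizontalPerm : Equiv.Perm (TangleClass 0 4) :=
  twistPerm 0 (D := horizontalTwist true) (E := horizontalTwist false) rfl rfl

/-- The half twist of the ends NW and NE, up to 5-moves. -/
def verticalPerm : Equiv.Perm (TangleClass 0 4) :=
  twistPerm 0 (D := verticalTwist true) (E := verticalTwist false) rfl rfl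

theorem twistRelations : TwistRelations horizontalPerm verticalPerm tangleZero.toClass
    tangleInfinity.toClass where
  braid := by
    ext x
    induction x using Quot.ind with
    | mk T =>
      exact toClass_eq_of_isotopyMove T.word [] (.reidemeisterThree true 1)
        (by simp [TangleDiagram.stack, horizontalTwist, verticalTwist])
        (by simp [TangleDiagram.stack, horizontalTwist, verticalTwist])
  h_pow := by
    ext x
    induction x using Quot.ind with
    | mk T =>
      exact (toClass_eq_of_fiveTwist T.word [] (.twist false 2) (by simp)
        (by simp [TangleDiagram.stack, horizontalTwist, List.replicate])).symm
  v_pow := by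
    ext x
    induction x using Quot.ind with
    | mk T =>
      exact (toClass_eq_of_fiveTwist T.word [] (.twist true 1) (by simp)
        (by simp [TangleDiagram.stack, verticalTwist, List.replicate])).symm
  h_inf := toClass_eq_of_isotopyMove [cup 0] [] (.reidemeisterOneCup false 2) rfl rfl
  v_zero := toClass_eq_of_isotopyMove [cup 0] [] (.reidemeisterOneCup true 1) rfl rfl
  v_inf := (toClass_eq_of_isotopyMove [cup 0] [] (.turnCup false 1) rfl rfl).symm
  v_inv_inf := (toClass_eq_of_isotopyMove [cup 0] [] (.turnCup true 1) rfl rfl).symm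

/-- The class of the rational tangles of slope `x / y` modulo 5. -/
def rationalClass (x y : ZMod 5) : TangleClass 0 4 :=
  slopePoint horizontalPerm verticalPerm tangleZero.toClass tangleInfinity.toClass x y

theorem IsRationalTangle.isCoprime {T : TangleDiagram 0 4} {p q : ℤ} (h : IsRationalTangle T p q) :
    IsCoprime p q := by
  induction h with
  | infinity => exact isCoprime_one_left
  | zero => exact isCoprime_one_right
  | horizontal s _ ih => exact ih.add_mul_right_left _
  | vertical s _ ih => exact ih.add_mul_right_right _

theorem intCast_ne_zero_or_ne_zero {p q : ℤ} (h : IsCoprime p q) :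
    (p : ZMod 5) ≠ 0 ∨ (q : ZMod 5) ≠ 0 :=
  (h.map (Int.castRingHom (ZMod 5))).ne_zero_or_ne_zero

theorem IsRationalTangle.toClass_eq {T : TangleDiagram 0 4} {p q : ℤ}
    (h : IsRationalTangle T p q) : T.toClass = rationalClass p q := by
  induction h with
  | infinity => rfl
  | zero =>
    rw [Int.cast_zero, Int.cast_one, rationalClass, slopePoint, if_neg one_ne_zero, zero_mul,
      ZMod.val_zero, pow_zero, one_smul, axisPoint, if_pos (one_pow 2)]
  | @horizontal T p q s _ ih =>
    cases s with
    | true =>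
      change horizontalPerm • T.toClass = _
      rw [ih, rationalClass, twistRelations.h_slopePoint, rationalClass]
      simp [sign]
    | false =>
      change horizontalPerm⁻¹ • T.toClass = _
      rw [ih, inv_smul_eq_iff, rationalClass, rationalClass, twistRelations.h_slopePoint]
      simp [sign]
  | @vertical T p q s h ih =>
    have hpq := intCast_ne_zero_or_ne_zero h.isCoprime
    have hpq' := intCast_ne_zero_or_ne_zero (h.vertical s).isCoprime
    cases s with
    | true =>
      change verticalPerm • T.toClass = _
      rw [ih, rationalClass, twistRelations.v_slopePoint hpq, rationalClass]
      simp [sign]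
    | false =>
      change verticalPerm⁻¹ • T.toClass = _
      rw [ih, inv_smul_eq_iff, rationalClass, rationalClass, twistRelations.v_slopePoint hpq']
      simp [sign]

/-- The class of the numerator of a tangle. -/
def numeratorClass (x : TangleClass 0 4) : TangleClass 0 0 :=
  x.stack ⟨[cap 1, cap 0], rfl⟩

theorem numeratorClass_vertical (x : TangleClass 0 4) :
    numeratorClass (verticalPerm • x) = numeratorClass x := by
  induction x using Quot.ind with
  | mk T =>
    exact toClass_eq_of_isotopyMove T.word [cap 0] (.reidemeisterOneCap true 1)
      (by simp [TangleDiagram.stack, verticalTwist]) (by simp [TangleDiagram.stack])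

theorem numeratorClass_vertical_pow (n : ℕ) (x : TangleClass 0 4) :
    numeratorClass (verticalPerm ^ n • x) = numeratorClass x := by
  induction n with
  | zero => rw [pow_zero, one_smul]
  | succ n ih => rw [pow_succ', mul_smul, numeratorClass_vertical, ih]

theorem exchange_caps {n : ℕ} {D E : TangleDiagram 0 n} (u : List Event)
    (hD : D.word = u ++ [cap 2, cap 0]) (hE : E.word = u ++ [cap 0, cap 0]) :
    D.toClass = E.toClass :=
  (toClass_eq_of_isotopyMove u [] (.exchange .cap .cap 0 0 le_rfl) (by simpa) (by simpa)).symm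

theorem numeratorClass_zero :
    numeratorClass tangleZero.toClass = trivialLinkTwo.toClass := by
  let D₁ : LinkDiagram := ⟨[cup 0, cup 1, cross true 2, cross false 2, cap 1, cap 0], rfl⟩
  let D₂ : LinkDiagram := ⟨[cup 0, cup 2, cross false 1, cross false 2, cap 1, cap 0], rfl⟩
  let D₃ : LinkDiagram := ⟨[cup 0, cup 2, cross false 1, cross true 1, cap 2, cap 0], rfl⟩
  let D₄ : LinkDiagram := ⟨[cup 0, cup 2, cap 2, cap 0], rfl⟩
  let D₅ : LinkDiagram := ⟨[cup 0, cup 2, cap 0, cap 0], rfl⟩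
  calc numeratorClass tangleZero.toClass
    _ = D₁.toClass := (toClass_eq_of_isotopyMove [cup 0, cup 1] [cap 1, cap 0]
        (.reidemeisterTwo true 2) rfl rfl).symm
    _ = D₂.toClass := toClass_eq_of_isotopyMove [cup 0] [cross false 2, cap 1, cap 0]
        (.turnCup true 1) rfl rfl
    _ = D₃.toClass := toClass_eq_of_isotopyMove [cup 0, cup 2, cross false 1] [cap 0]
        (.turnCap false 1) rfl rfl
    _ = D₄.toClass := toClass_eq_of_isotopyMove [cup 0, cup 2] [cap 2, cap 0]
        (.reidemeisterTwo false 1) rfl rfl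
    _ = D₅.toClass := exchange_caps [cup 0, cup 2] rfl rfl
    _ = trivialLinkTwo.toClass := (toClass_eq_of_isotopyMove [cup 0] [cap 0]
        (.exchange .cap .cup 0 0 le_rfl) rfl rfl).symm

theorem numeratorClass_infinity :
    numeratorClass tangleInfinity.toClass = trivialKnot.toClass :=
  toClass_eq_of_isotopyMove [cup 0] [cap 0] (.zigzagLeft 1) rfl rfl

theorem numeratorClass_two :
    numeratorClass (horizontalPerm ^ 2 • tangleZero.toClass) = hopfLink.toClass := by
  let D₁ : LinkDiagram := ⟨[cup 0, cup 1, cross false 2, cross false 2, cap 1, cap 0], rfl⟩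
  let D₂ : LinkDiagram := ⟨[cup 0, cup 2, cross true 1, cross false 2, cap 1, cap 0], rfl⟩
  let D₃ : LinkDiagram := ⟨[cup 0, cup 2, cross true 1, cross true 1, cap 2, cap 0], rfl⟩
  calc numeratorClass (horizontalPerm ^ 2 • tangleZero.toClass)
    _ = D₁.toClass := rfl
    _ = D₂.toClass :=
        toClass_eq_of_isotopyMove [cup 0] [cross false 2, cap 1, cap 0] (.turnCup false 1) rfl rfl
    _ = D₃.toClass :=
        toClass_eq_of_isotopyMove [cup 0, cup 2, cross true 1] [cap 0] (.turnCap false 1) rfl rfl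
    _ = hopfLink.toClass := exchange_caps [cup 0, cup 2, cross true 1, cross true 1] rfl rfl

theorem numeratorClass_two_add_half :
    numeratorClass (horizontalPerm ^ 2 • verticalPerm ^ 2 • tangleInfinity.toClass) =
      figureEight.toClass :=
  rfl

/-- The four links to which every rational link is 5-move equivalent. -/
def representative : Fin 4 → LinkDiagram := ![trivialLinkTwo, figureEight, trivialKnot, hopfLink]

/-- The index of the representative of the rational links of type `x / y`. -/
def linkIndex (x y : ZMod 5) : Fin 4 :=
  if x = 0 then if y ^ 2 = 1 then 0 else 1 else if x ^ 2 = 1 then 2 else 3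

theorem numeratorClass_rationalClass {x y : ZMod 5} (hxy : x ≠ 0 ∨ y ≠ 0) :
    numeratorClass (rationalClass x y) = (representative (linkIndex x y)).toClass := by
  rw [rationalClass, twistRelations.slopePoint_swap hxy, slopePoint, linkIndex]
  split_ifs with hx hy hx'
  · rw [axisPoint, if_pos hy, numeratorClass_zero]
    rfl
  · rw [axisPoint, if_neg hy, numeratorClass_two_add_half]
    rfl
  · rw [numeratorClass_vertical_pow, axisPoint, if_pos hx', numeratorClass_infinity]
    rfl
  · rw [numeratorClass_vertical_pow, axisPoint, if_neg hx', numeratorClass_vertical_pow,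
      numeratorClass_two]
    rfl

theorem IsRationalLink.fiveMoveEquiv_representative {L : LinkDiagram} {p q : ℤ}
    (hL : IsRationalLink L p q) : FiveMoveEquiv L (representative (linkIndex p q)) := by
  obtain ⟨T, hT, hL⟩ := hL
  have hTpq : IsCoprime p q ∧ T.toClass = rationalClass p q := by
    rcases hT with hT | hT
    · exact ⟨hT.isCoprime, hT.toClass_eq⟩
    · refine ⟨(IsCoprime.neg_neg_iff p q).mp hT.isCoprime, ?_⟩
      rw [hT.toClass_eq, rationalClass, Int.cast_neg, Int.cast_neg, slopePoint_neg, rationalClass]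
  rw [← toClass_eq_iff, ← numeratorClass_rationalClass (intCast_ne_zero_or_ne_zero hTpq.1),
    ← hTpq.2]
  exact hL.toClass_eq

/-- The brackets of the four representatives. -/
def BracketModel.linkBracket {R E : Type*} [CommRing R] [Ring E] [Algebra R E]
    (M : BracketModel R E) : Fin 4 → R :=
  ![M.loopValue ^ 2,
    ((M.A : R) ^ 8 - (M.A : R) ^ 4 + 1 - (↑M.A⁻¹ : R) ^ 4 + (↑M.A⁻¹ : R) ^ 8) * M.loopValue,
    M.loopValue,
    -((M.A : R) ^ 4 + (↑M.A⁻¹ : R) ^ 4) * M.loopValue]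

theorem BracketModel.bracket_representative {R E : Type*} [CommRing R] [Ring E] [Algebra R E]
    (M : BracketModel R E) (i : Fin 4) :
    M.bracket (representative i).word = M.linkBracket i • 1 := by
  fin_cases i
  exacts [M.bracket_trivialLinkTwo, M.bracket_figureEight, M.bracket_trivialKnot,
    M.bracket_hopfLink]

theorem representative_fiveMoveEquiv_iff {i j : Fin 4} :
    FiveMoveEquiv (representative i) (representative j) ↔ i = j := by
  refine ⟨fun h => ?_, fun h => h ▸ .refl _⟩
  have separates : ∀ i j, modularModel.linkBracket i ^ 40 = modularModel.linkBracket j ^ 40 →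
      i = j := by
    unfold BracketModel.linkBracket BracketModel.loopValue
    decide
  exact separates i j (h.pow_forty_eq modularModel isFiveMoveRoot_modularModel
    (modularModel.bracket_representative i) (modularModel.bracket_representative j))

theorem IsRationalLink.fiveMoveEquiv_representative_iff {L : LinkDiagram} {p q : ℤ}
    (hL : IsRationalLink L p q) (i : Fin 4) :
    FiveMoveEquiv L (representative i) ↔ linkIndex p q = i := by
  rw [← representative_fiveMoveEquiv_iff, ← toClass_eq_iff, ← toClass_eq_iff,
    toClass_eq_iff.mpr hL.fiveMoveEquiv_representative]

theorem linkIndex_eq_iff {x y : ZMod 5} (hxy : x ≠ 0 ∨ y ≠ 0) :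
    (linkIndex x y = 0 ↔ x = 0 ∧ (y = 1 ∨ y = -1)) ∧
    (linkIndex x y = 1 ↔ x = 0 ∧ (y = 2 ∨ y = -2)) ∧
    (linkIndex x y = 2 ↔ x = 1 ∨ x = -1) ∧
    (linkIndex x y = 3 ↔ x = 2 ∨ x = -2) := by
  revert x y
  decide

end FiveMove

theorem corollary2p12 (L : FiveMove.LinkDiagram) (p q : ℤ) (hpq : IsCoprime p q)
    (hL : FiveMove.IsRationalLink L p q) :
    (FiveMove.FiveMoveEquiv L FiveMove.trivialLinkTwo ↔
      p ≡ 0 [ZMOD 5] ∧ (q ≡ 1 [ZMOD 5] ∨ q ≡ -1 [ZMOD 5])) ∧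
    (FiveMove.FiveMoveEquiv L FiveMove.figureEight ↔
      p ≡ 0 [ZMOD 5] ∧ (q ≡ 2 [ZMOD 5] ∨ q ≡ -2 [ZMOD 5])) ∧
    (FiveMove.FiveMoveEquiv L FiveMove.trivialKnot ↔
      (p ≡ 1 [ZMOD 5] ∨ p ≡ -1 [ZMOD 5])) ∧
    (FiveMove.FiveMoveEquiv L FiveMove.hopfLink ↔
      (p ≡ 2 [ZMOD 5] ∨ p ≡ -2 [ZMOD 5])) := by
  have hmod (a b : ℤ) : a ≡ b [ZMOD 5] ↔ (a : ZMod 5) = b :=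
    (ZMod.intCast_eq_intCast_iff a b 5).symm
  have hindex := FiveMove.linkIndex_eq_iff (FiveMove.intCast_ne_zero_or_ne_zero hpq)
  simp only [← hL.fiveMoveEquiv_representative_iff] at hindex
  simp only [hmod, Int.cast_zero, Int.cast_one, Int.cast_neg, Int.cast_ofNat]
  exact hindex
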